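/- Let $G=(V,E)$ be a finite connected simple graph with edge capacities $c:E\to\mathbb R_{\ge 0}$. An escrow configuration assigns to each edge $\{u,v\}$ numbers $w(u,v),w(v,u)\ge 0$ with $w(u,v)+w(v,u)=c(\{u,v\})$. The transaction of size $k>0$ from $x$ to $y$ (where $x\ne y$ are vertices) succeeds in $w$ if there is a flow $f\ge 0$ carrying $k$ units from $x$ to $y$ with $f(u,v)\le w(u,v)$ for every directed edge $(u,v)$. Let $n=|V|-1$. Fix an orientation $s$ of the edges, that is, $s(u,v)=-s(v,u)\in\{\pm1\}$ for every edge $\{u,v\}$. Let $D:E\to\mathbb R^n$ be any spanning representation: the signed sum $\sum_i s(v_i,v_{i+1})D(\{v_i,v_{i+1}\})$ along a walk $v_0,\dots,v_t$ is $0$ if and only if $v_0=v_t$, and for every spanning tree $T$ of $G$ the vectors $D(e)$, $e\in T$, span $\mathbb R^n$. Put $S(w)=\sum_{(u,v):\,s(u,v)=1}w(u,v)\,D(\{u,v\})$. The success probability of the transaction is with respect to the uniform distribution on the image of the configurations under $S$, that is, $$p_{x,y}(k)=\frac{\operatorname{vol}\{S(w): w\text{ a configuration in which the transaction succeeds}\}}{\operatorname{vol}\{S(w):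 w\text{ a configuration}\}} .$$ Let $\Gamma(c)=\sum_T\prod_{e\in T}c(e)$, summed over the spanning trees $T$ of $G$, and let $\Gamma_{x=y}(c)$ be the same sum for the multigraph obtained from $G$ by identifying $x$ and $y$. Assume $\Gamma(c)\neq 0$ (equivalently, the edges of positive capacity connect all vertices). Then $$p_{x,y}(k)\;\ge\;1-k\,\frac{\Gamma_{x=y}(c)}{\Gamma(c)},$$ and equality holds if and only if $G$ has an edge between $x$ and $y$ with $c(\{x,y\})\ge k$. -/

import Mathlib

open MeasureTheory
open scoped NNReal

namespace CreditNetwork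

/-! ### Spanning trees and generating polynomials of finite multigraphs

A multigraph on the vertex type `W` is given by its edge type `ι` and the map `ends` that sends an
edge to its unordered pair of endpoints; loops and parallel edges are allowed. -/

/-- `b` can be reached from `a` along edges of `T`. -/
def Reach {W ι : Type*} (ends : ι → Sym2 W) (T : Finset ι) : W → W → Prop :=
  Relation.ReflTransGen fun a b => ∃ e ∈ T, ends e = s(a, b)

/-- `T` is a spanning tree: it connects all vertices, and it contains no cycle, that is, no edge of
`T` has endpoints that are joined by the remaining edges of `T` (in particular, no loop). -/
def IsSpanningTree {W ι : Type*} [DecidableEq ι] (ends : ι → Sym2 W) (T : Finset ι) : Prop :=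
  (∀ a b, Reach ends T a b) ∧
    ∀ e ∈ T, ∀ a b, ends e = s(a, b) → ¬ Reach ends (T.erase e) a b

open Classical in
/-- The generating polynomial of the spanning trees, `∑_T ∏_{e ∈ T} y_e`. -/
noncomputable def genPoly {W ι : Type*} [Fintype ι] (ends : ι → Sym2 W) : MvPolynomial ι ℝ :=
  ∑ T : Finset ι with IsSpanningTree ends T, ∏ e ∈ T, MvPolynomial.X e

variable {V : Type*}

/-- The endpoints of the edges of `G`. -/
def graphEnds (G : SimpleGraph V) : G.edgeSet → Sym2 V := fun e => e.1

/-- The endpoints of the edges of `G` after the vertices `x` and `y` have been identified. -/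
def identEnds (G : SimpleGraph V) (x y : V) :
    G.edgeSet → Sym2 (Quot fun a b : V => a = x ∧ b = y) :=
  fun e => Sym2.map (Quot.mk _) e.1

/-- `Γ(c)`: the generating polynomial of `G`, evaluated at the capacities. -/
noncomputable def Gam (G : SimpleGraph V) [Fintype G.edgeSet] (c : G.edgeSet → ℝ≥0) : ℝ :=
  MvPolynomial.eval (fun e => (c e : ℝ)) (genPoly (graphEnds G))

/-- `Γ_{x=y}(c)`: the generating polynomial of `G` with `x` and `y` identified, evaluated at the
capacities. -/
noncomputable def GamIdent (G : SimpleGraph V) [Fintype G.edgeSet] (c : G.edgeSet → ℝ≥0)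
    (x y : V) : ℝ :=
  MvPolynomial.eval (fun e => (c e : ℝ)) (genPoly (identEnds G x y))

/-! ### Configurations and transactions -/

/-- The undirected edge underlying a dart (an edge with a direction). -/
def dartEdge {G : SimpleGraph V} (d : G.Dart) : G.edgeSet := ⟨d.edge, d.edge_mem⟩

/-- Escrow configurations: `w (u, v)` is what `u` owns of the escrow on the edge `{u, v}`. -/
def IsConfig {G : SimpleGraph V} (c : G.edgeSet → ℝ≥0) (w : G.Dart → ℝ) : Prop :=
  (∀ d, 0 ≤ w d) ∧ ∀ d, w d + w d.symm = c (dartEdge d)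

/-- `f` is a flow that takes `k` units from `x` to `y`. -/
def IsFlow [Fintype V] [DecidableEq V] {G : SimpleGraph V} [DecidableRel G.Adj]
    (f : G.Dart → ℝ) (x y : V) (k : ℝ) : Prop :=
  (∀ d, 0 ≤ f d) ∧
    ∀ u, (∑ d : G.Dart with d.fst = u, f d) - (∑ d : G.Dart with d.snd = u, f d) =
      (if u = x then k else 0) - (if u = y then k else 0)

/-- The transaction of size `k` from `x` to `y` succeeds in the configuration `w`. -/
def Succeeds [Fintype V] [DecidableEq V] {G : SimpleGraph V} [DecidableRel G.Adj]
    (w : G.Dart → ℝ) (x y : V) (k : ℝ) : Prop :=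
  ∃ f : G.Dart → ℝ, IsFlow f x y k ∧ ∀ d, f d ≤ w d

/-! ### Spanning representations -/

/-- An orientation: each edge is positive in exactly one of its two directions. -/
def IsOrientation {G : SimpleGraph V} (s : G.Dart → ℤˣ) : Prop :=
  ∀ d, s d.symm = - s d

/-- The direction of a walk: the signed sum of `D` along it. -/
noncomputable def walkDir {G : SimpleGraph V} {n : ℕ} (s : G.Dart → ℤˣ)
    (D : G.edgeSet → EuclideanSpace ℝ (Fin n)) {u v : V} (p : G.Walk u v) :
    EuclideanSpace ℝ (Fin n) :=
  (p.darts.map fun d => ((s d : ℤ) : ℝ) • D (dartEdge d)).sum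

/-- `D` is a spanning representation: the walks of direction `0` are exactly the closed ones, and
every spanning tree of `G` is mapped to a spanning set. -/
def IsSpanningRep [DecidableEq V] {G : SimpleGraph V} {n : ℕ} (s : G.Dart → ℤˣ)
    (D : G.edgeSet → EuclideanSpace ℝ (Fin n)) : Prop :=
  (∀ (u v : V) (p : G.Walk u v), walkDir s D p = 0 ↔ u = v) ∧
    ∀ T : Finset G.edgeSet, IsSpanningTree (graphEnds G) T →
      Submodule.span ℝ (D '' (T : Set G.edgeSet)) = ⊤

/-- The represented score of a configuration: the sum of `w d • D d` over positive darts. -/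
noncomputable def score [Fintype V] [DecidableEq V] {G : SimpleGraph V} [DecidableRel G.Adj] {n : ℕ}
    (s : G.Dart → ℤˣ) (D : G.edgeSet → EuclideanSpace ℝ (Fin n)) (w : G.Dart → ℝ) :
    EuclideanSpace ℝ (Fin n) :=
  ∑ d : G.Dart with s d = 1, w d • D (dartEdge d)

/-- The probability, under the uniform distribution on the image of the set of configurations, that
the transaction of size `k` from `x` to `y` succeeds: the relative volume of the image of the set of
configurations in which it succeeds. -/
noncomputable def successProb [Fintype V] [DecidableEq V] {G : SimpleGraph V} [DecidableRel G.Adj]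
    {n : ℕ} (s : G.Dart → ℤˣ) (D : G.edgeSet → EuclideanSpace ℝ (Fin n)) (c : G.edgeSet → ℝ≥0)
    (x y : V) (k : ℝ) : ℝ :=
  volume.real (score s D '' {w | IsConfig c w ∧ Succeeds w x y k}) /
    volume.real (score s D '' {w | IsConfig c w})

end CreditNetwork

/-! Closed walks have direction zero, so `D` is the difference of a vertex potential
(`exists_potential`). After an invertible linear change of coordinates, whose determinant cancels in
the ratio of volumes, the vertices become the origin and the standard basis vectors
(`exists_score_eq`). The scores of all configurations then form the graphical zonotope Z, the sum of
the segments [0, c(e)] · (ψ(head) − ψ(tail)).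

A payment moves the score by kd with d = ψ(x) − ψ(y). Conversely, affine independence of the ψ(v)
lets a score difference determine the divergence of a flow. Hence the transaction succeeds exactly
for the scores z with both z and z + kd in Z (`image_potentialScore_succeeds`). Inclusion–exclusion
gives vol(Z ∩ (Z + kd)) = 2 vol Z − vol(Z ∪ (Z + kd)), and the union lies in Z + [0, kd]
(`volume_inter_translate`).

By Cavalieri, extending a convex body along an edge vector adds the length times the volume of the
projection along it, and projecting contracts the edge. This is the deletion–contraction recursion
of spanning trees, so vol Z = Γ(c) (`volume_zonotope`) and vol(Z + [0, kd]) = Γ(c) + k Γ_{x=y}(c).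

Equality means that Z and Z + kd cover Z + [0, kd]. An edge xy of capacity at least k provides the
cover (`cover_of_edge`). Otherwise a functional that agrees on x and y but separates all other pairs
exposes a face of Z that is a point or a segment along d shorter than k, and a gap remains between
this face and its translate (`exists_edge_of_cover`). -/

namespace CreditNetwork

/-! ### Spanning trees under deletion and contraction -/

section Trees

variable {W W' ι : Type*} {ends : ι → Sym2 W} {S T : Finset ι}

theorem Reach.symm {a b : W} (h : Reach ends T a b) : Reach ends T b a := by
  induction h with
  | refl => exact .refl
  | tail _ hs ih =>
    obtain ⟨e, he, hab⟩ := hs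
    exact .head ⟨e, he, hab.trans Sym2.eq_swap⟩ ih

theorem Reach.mono (hST : S ⊆ T) {a b : W} (h : Reach ends S a b) : Reach ends T a b :=
  Relation.ReflTransGen.mono (fun _ _ ⟨e, he, hab⟩ => ⟨e, hST he, hab⟩) _ _ h

theorem Reach.trans {a b d : W} (h : Reach ends T a b) (h' : Reach ends T b d) :
    Reach ends T a d :=
  Relation.ReflTransGen.trans h h'

theorem reach_of_mem {e : ι} (he : e ∈ T) {a b : W} (hab : ends e = s(a, b)) :
    Reach ends T a b :=
  .single ⟨e, he, hab⟩

theorem reach_map_equiv_iff (g : W ≃ W') (a b : W) :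
    Reach (fun i => (ends i).map g) T (g a) (g b) ↔ Reach ends T a b := by
  constructor
  · intro h
    have := Relation.ReflTransGen.lift
      (p := fun a b => ∃ e ∈ T, ends e = s(a, b)) g.symm ?_ _ _ h
    · rw [Function.onFun, g.symm_apply_apply, g.symm_apply_apply] at this
      exact this
    · rintro a b ⟨e, he, hab⟩
      refine ⟨e, he, ?_⟩
      have := congrArg (Sym2.map g.symm) hab
      simpa [Sym2.map_map] using this
  · exact Relation.ReflTransGen.lift g (fun a b ⟨e, he, hab⟩ => ⟨e, he, by simp [hab]⟩) _ _

variable [DecidableEq ι]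

/-- A connection that needs the edge `e` runs through `e` in one of its two directions. -/
theorem Reach.of_insert {e : ι} {p r a b : W} (he : ends e = s(p, r))
    (h : Reach ends (insert e T) a b) :
    Reach ends T a b ∨ (Reach ends T a p ∧ Reach ends T r b) ∨
      (Reach ends T a r ∧ Reach ends T p b) := by
  induction h with
  | refl => exact .inl .refl
  | tail _ hs ih =>
    obtain ⟨e', he', hbc⟩ := hs
    rcases Finset.mem_insert.1 he' with rfl | he'
    · rw [he, Sym2.eq_iff] at hbc
      rcases hbc with ⟨rfl, rfl⟩ | ⟨rfl, rfl⟩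
      · rcases ih with h | ⟨h, h'⟩ | ⟨h, h'⟩
        · exact .inr (.inl ⟨h, .refl⟩)
        · exact .inr (.inl ⟨h, .refl⟩)
        · exact .inl h
      · rcases ih with h | ⟨h, h'⟩ | ⟨h, h'⟩
        · exact .inr (.inr ⟨h, .refl⟩)
        · exact .inl h
        · exact .inr (.inr ⟨h, .refl⟩)
    · have := reach_of_mem he' hbc
      rcases ih with h | ⟨h, h'⟩ | ⟨h, h'⟩
      · exact .inl (h.trans this)
      · exact .inr (.inl ⟨h, h'.trans this⟩)
      · exact .inr (.inr ⟨h, h'.trans this⟩)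

/-- `q` identifies the vertices `x` and `y`, and no others. -/
structure Identifies (q : W → W') (x y : W) : Prop where
  surj : Function.Surjective q
  eq_iff : ∀ a b, q a = q b ↔ a = b ∨ (a = x ∧ b = y) ∨ (a = y ∧ b = x)

theorem Identifies.swap {q : W → W'} {x y : W} (hq : Identifies q x y) : Identifies q y x :=
  ⟨hq.surj, fun a b => by rw [hq.eq_iff]; tauto⟩

variable {q : W → W'} {x y : W}

/-- A step after the identification lifts to a step before it, except that consecutive lifts may sit
at different preimages of the merged vertex; `e` bridges these. -/
theorem reach_map_iff (hq : Identifies q x y) {e : ι} (he : ends e = s(x, y)) (a b : W) :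
    Reach (fun i => (ends i).map q) T (q a) (q b) ↔ Reach ends (insert e T) a b := by
  have hxy : Reach ends (insert e T) x y := reach_of_mem (Finset.mem_insert_self _ _) he
  have key : ∀ a b, q a = q b → Reach ends (insert e T) a b := by
    intro a b h
    rcases (hq.eq_iff a b).1 h with rfl | ⟨rfl, rfl⟩ | ⟨rfl, rfl⟩
    exacts [.refl, hxy, hxy.symm]
  constructor
  · intro h
    generalize hb : q b = b' at h
    induction h generalizing b with
    | refl => exact key _ _ hb.symm
    | tail _ hs ih =>
      obtain ⟨e', he', hbc⟩ := hs
      subst hb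
      obtain ⟨⟨u, v⟩, huv⟩ : ∃ z : W × W, ends e' = s(z.1, z.2) :=
        ⟨(Quot.out (ends e')), (Quot.out_eq (ends e')).symm⟩
      simp only [huv, Sym2.map_mk, Sym2.eq_iff] at hbc
      have hstep := reach_of_mem (T := insert e T) (Finset.mem_insert_of_mem he') huv
      rcases hbc with ⟨h1, h2⟩ | ⟨h1, h2⟩
      · exact ((ih u h1).trans hstep).trans (key _ _ h2)
      · exact ((ih v h2).trans hstep.symm).trans (key _ _ h1)
  · intro h
    induction h with
    | refl => exact .refl
    | @tail b d _ hs ih =>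
      obtain ⟨e', he', hbc⟩ := hs
      rcases Finset.mem_insert.1 he' with rfl | he'
      · have : q b = q d := by
          rw [hq.eq_iff]
          rw [he, Sym2.eq_iff] at hbc
          tauto
        rwa [← this]
      · exact ih.trans (reach_of_mem he' (by simp [hbc]))

/-- Spanning trees that contain `e` are spanning trees of the graph in which `e` is contracted. -/
theorem isSpanningTree_insert_iff (hq : Identifies q x y) (hxy : x ≠ y) {e : ι}
    (he : ends e = s(x, y)) (heT : e ∉ T) :
    IsSpanningTree ends (insert e T) ↔ IsSpanningTree (fun i => (ends i).map q) T := by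
  have hconn : (∀ a b, Reach ends (insert e T) a b) ↔
      ∀ a b, Reach (fun i => (ends i).map q) T a b := by
    simp only [hq.surj.forall, reach_map_iff hq he]
  have herase : ∀ e' ∈ T, insert e (T.erase e') = (insert e T).erase e' := by
    intro e' he'
    rw [Finset.erase_insert_of_ne]
    rintro rfl
    exact heT he'
  unfold IsSpanningTree
  rw [hconn]
  refine and_congr_right fun _ => ⟨fun h e' he' a' b' hab hr => ?_, fun h e' he' a b hab hr => ?_⟩
  · obtain ⟨⟨u, v⟩, huv⟩ : ∃ z : W × W, ends e' = s(z.1, z.2) :=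
      ⟨(Quot.out (ends e')), (Quot.out_eq (ends e')).symm⟩
    have hn := h e' (Finset.mem_insert_of_mem he') u v huv
    rw [← herase e' he', ← reach_map_iff hq he] at hn
    simp only [huv, Sym2.map_mk, Sym2.eq_iff] at hab
    rcases hab with ⟨rfl, rfl⟩ | ⟨rfl, rfl⟩
    exacts [hn hr, hn hr.symm]
  · have hT : ∀ e' ∈ T, ∀ a b, ends e' = s(a, b) → ¬ Reach ends (insert e (T.erase e')) a b := by
      intro e' he' a b hab hr
      rw [← reach_map_iff hq he] at hr
      exact h e' he' _ _ (by simp [hab]) hr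
    rcases Finset.mem_insert.1 he' with rfl | he'
    · rw [Finset.erase_insert heT] at hr
      -- Edges are added one at a time: the first edge `i` that joined `x` to `y` would close a
      -- cycle with `e'`, so its endpoints would stay joined without it, against `hT`.
      have claim : ∀ S : Finset ι, S ⊆ T → ¬ Reach ends S x y := by
        intro S
        induction S using Finset.induction_on with
        | empty =>
          intro _ hr
          rcases Relation.ReflTransGen.cases_head hr with h | ⟨_, ⟨_, h, _⟩, _⟩
          · exact hxy h
          · simp at h
        | insert i S hi ih =>
          intro hS hr
          have hiT := hS (Finset.mem_insert_self _ _)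
          obtain ⟨⟨u, v⟩, huv⟩ : ∃ z : W × W, ends i = s(z.1, z.2) :=
            ⟨(Quot.out (ends i)), (Quot.out_eq (ends i)).symm⟩
          have hS' : S ⊆ insert e' (T.erase i) := fun j hj =>
            Finset.mem_insert_of_mem (Finset.mem_erase.2
              ⟨fun h => hi (h ▸ hj), hS (Finset.mem_insert_of_mem hj)⟩)
          have hst : Reach ends (insert e' (T.erase i)) x y :=
            reach_of_mem (Finset.mem_insert_self _ _) he
          apply hT i hiT u v huv
          rcases hr.of_insert huv with h | ⟨h1, h2⟩ | ⟨h1, h2⟩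
          · exact absurd h (ih ((Finset.subset_insert _ _).trans hS))
          · exact ((h1.mono hS').symm.trans hst).trans (h2.mono hS').symm
          · exact ((h2.mono hS').trans hst.symm).trans (h1.mono hS')
      rw [he, Sym2.eq_iff] at hab
      rcases hab with ⟨rfl, rfl⟩ | ⟨rfl, rfl⟩
      exacts [claim T subset_rfl hr, claim T subset_rfl hr.symm]
    · rw [← herase e' he'] at hr
      exact hT e' he' a b hab hr

theorem isSpanningTree_map_equiv_iff (g : W ≃ W') :
    IsSpanningTree (fun i => (ends i).map g) T ↔ IsSpanningTree ends T := by
  unfold IsSpanningTree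
  simp only [g.surjective.forall, reach_map_equiv_iff]
  refine and_congr_right fun _ => forall₂_congr fun e _ => forall₂_congr fun a b => ?_
  have : s(g a, g b) = Sym2.map g s(a, b) := rfl
  rw [this, (Sym2.map.injective g.injective).eq_iff]

/-- Which sets are spanning trees after an identification depends only on the vertices that are
identified. -/
theorem Identifies.isSpanningTree_iff {W₂ : Type*} {q₂ : W → W₂} (hq : Identifies q x y)
    (hq₂ : Identifies q₂ x y) :
    IsSpanningTree (fun i => (ends i).map q) T ↔
      IsSpanningTree (fun i => (ends i).map q₂) T := by
  have hk : ∀ a b, q a = q b ↔ q₂ a = q₂ b := fun a b => by rw [hq.eq_iff, hq₂.eq_iff]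
  let r : W' → W₂ := fun z => q₂ (Function.surjInv hq.surj z)
  have hr : ∀ a, r (q a) = q₂ a := fun a => (hk _ _).1 (Function.surjInv_eq hq.surj _)
  have hbij : Function.Bijective r := by
    constructor
    · intro u v
      obtain ⟨a, rfl⟩ := hq.surj u
      obtain ⟨b, rfl⟩ := hq.surj v
      rw [hr, hr, hk]
      exact id
    · intro z
      obtain ⟨a, rfl⟩ := hq₂.surj z
      exact ⟨q a, hr a⟩
  rw [← isSpanningTree_map_equiv_iff (Equiv.ofBijective r hbij)]
  have : (fun i => ((ends i).map q).map (Equiv.ofBijective r hbij)) =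
      fun i => (ends i).map q₂ := by
    funext i
    rw [Sym2.map_map]
    congr 1
    funext a
    exact hr a
  rw [this]

theorem not_isSpanningTree_insert_of_loop {e : ι} {a : W} (he : ends e = s(a, a)) :
    ¬ IsSpanningTree ends (insert e T) :=
  fun h => h.2 e (Finset.mem_insert_self _ _) a a he .refl

open Classical in
/-- The weighted number of spanning trees with edges in `A`. -/
noncomputable def treeSum (ends : ι → Sym2 W) (c : ι → ℝ≥0) (A : Finset ι) : ℝ≥0 :=
  ∑ T ∈ A.powerset, if IsSpanningTree ends T then ∏ e ∈ T, c e else 0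

theorem treeSum_insert_loop {c : ι → ℝ≥0} {A : Finset ι} {e : ι} (heA : e ∉ A) {a : W}
    (he : ends e = s(a, a)) : treeSum ends c (insert e A) = treeSum ends c A := by
  unfold treeSum
  rw [Finset.sum_powerset_insert heA]
  simp [not_isSpanningTree_insert_of_loop he]

/-- Deletion and contraction. -/
theorem treeSum_insert {c : ι → ℝ≥0} {A : Finset ι} {e : ι} (heA : e ∉ A)
    (hq : Identifies q x y) (hxy : x ≠ y) (he : ends e = s(x, y)) :
    treeSum ends c (insert e A) =
      treeSum ends c A + c e * treeSum (fun i => (ends i).map q) c A := by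
  unfold treeSum
  rw [Finset.sum_powerset_insert heA, Finset.mul_sum]
  congr 1
  refine Finset.sum_congr rfl fun T hT => ?_
  have heT : e ∉ T := fun h => heA (Finset.mem_powerset.1 hT h)
  rw [mul_ite, mul_zero, Finset.prod_insert heT]
  classical exact if_congr (isSpanningTree_insert_iff hq hxy he heT) rfl rfl

theorem treeSum_map_equiv (g : W ≃ W') (c : ι → ℝ≥0) (A : Finset ι) :
    treeSum (fun i => (ends i).map g) c A = treeSum ends c A := by
  classical exact Finset.sum_congr rfl fun T _ => if_congr (isSpanningTree_map_equiv_iff g) rfl rfl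

theorem Identifies.treeSum_eq {W₂ : Type*} {q₂ : W → W₂} (hq : Identifies q x y)
    (hq₂ : Identifies q₂ x y) (c : ι → ℝ≥0) (A : Finset ι) :
    treeSum (fun i => (ends i).map q) c A = treeSum (fun i => (ends i).map q₂) c A := by
  classical exact Finset.sum_congr rfl fun T _ => if_congr (hq.isSpanningTree_iff hq₂) rfl rfl

theorem treeSum_empty_of_subsingleton [Subsingleton W] (c : ι → ℝ≥0) :
    treeSum ends c ∅ = 1 := by
  have : IsSpanningTree ends (∅ : Finset ι) :=
    ⟨fun a b => Subsingleton.elim a b ▸ .refl, by simp⟩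
  simp [treeSum, this]

theorem treeSum_empty_of_nontrivial [Nontrivial W] (c : ι → ℝ≥0) :
    treeSum ends c ∅ = 0 := by
  have : ¬ IsSpanningTree ends (∅ : Finset ι) := by
    intro h
    obtain ⟨a, b, hab⟩ := exists_pair_ne W
    rcases Relation.ReflTransGen.cases_head (h.1 a b) with h | ⟨_, ⟨_, h, _⟩, _⟩
    · exact hab h
    · simp at h
  simp [treeSum, this]

theorem eval_genPoly [Fintype ι] (ends : ι → Sym2 W) (c : ι → ℝ≥0) :
    MvPolynomial.eval (fun e => (c e : ℝ)) (genPoly ends) = treeSum ends c Finset.univ := by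
  unfold genPoly treeSum
  rw [map_sum, Finset.sum_filter, Finset.powerset_univ, NNReal.coe_sum]
  refine Finset.sum_congr rfl fun T _ => ?_
  -- `genPoly` uses the classical decidable equality on `ι`, `treeSum` the ambient one.
  have : (fun a b => Classical.propDecidable (a = b)) = (inferInstance : DecidableEq ι) :=
    Subsingleton.elim _ _
  rw [this]
  split_ifs <;> simp

end Trees

/-! ### Volumes of graphical zonotopes -/

section Volume

open scoped Pointwise

/-- The origin and the standard basis vectors. -/
noncomputable def node {n : ℕ} (o : Option (Fin n)) : Fin n → ℝ :=
  o.elim 0 fun j => Pi.single j 1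

/-- The zonotope of the vectors `c e • a e`, `e ∈ A`. -/
def zonotope {ι E : Type*} [AddCommGroup E] [Module ℝ E] (A : Finset ι) (a : ι → E)
    (c : ι → ℝ≥0) : Set E :=
  (fun t : ι → ℝ => ∑ e ∈ A, t e • a e) '' Set.Icc 0 fun e => (c e : ℝ)

/-- The segment from `0` to `c • v`. -/
def originSegment {E : Type*} [AddCommGroup E] [Module ℝ E] (c : ℝ≥0) (v : E) : Set E :=
  (fun τ : ℝ => τ • v) '' Set.Icc 0 (c : ℝ)

section Basic

variable {ι E F : Type*} [AddCommGroup E] [Module ℝ E] [AddCommGroup F] [Module ℝ F]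

theorem image_zonotope (L : E →ₗ[ℝ] F) (A : Finset ι) (a : ι → E) (c : ι → ℝ≥0) :
    L '' zonotope A a c = zonotope A (fun e => L (a e)) c := by
  simp only [zonotope, Set.image_image, map_sum, map_smul]

theorem image_originSegment (L : E →ₗ[ℝ] F) (c : ℝ≥0) (v : E) :
    L '' originSegment c v = originSegment c (L v) := by
  simp only [originSegment, Set.image_image, map_smul]

theorem zonotope_insert [DecidableEq ι] {A : Finset ι} {e : ι} (he : e ∉ A) (a : ι → E)
    (c : ι → ℝ≥0) :
    zonotope (insert e A) a c = zonotope A a c + originSegment (c e) (a e) := by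
  ext z
  simp only [zonotope, originSegment, Set.mem_add, Set.mem_image]
  constructor
  · rintro ⟨t, ht, rfl⟩
    exact ⟨_, ⟨t, ht, rfl⟩, _, ⟨t e, ⟨ht.1 e, ht.2 e⟩, rfl⟩, by
      rw [Finset.sum_insert he, add_comm]⟩
  · rintro ⟨_, ⟨t, ht, rfl⟩, _, ⟨τ, hτ, rfl⟩, rfl⟩
    refine ⟨Function.update t e τ, ⟨fun i => ?_, fun i => ?_⟩, ?_⟩
    · by_cases hi : i = e
      · subst hi; simpa using hτ.1
      · simpa [hi] using ht.1 i
    · by_cases hi : i = e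
      · subst hi; simpa using hτ.2
      · simpa [hi] using ht.2 i
    · rw [Finset.sum_insert he, add_comm, Function.update_self]
      congr 1
      refine Finset.sum_congr rfl fun i hi => ?_
      rw [Function.update_of_ne (ne_of_mem_of_not_mem hi he)]

theorem convex_zonotope (A : Finset ι) (a : ι → E) (c : ι → ℝ≥0) :
    Convex ℝ (zonotope A a c) := by
  set L : (ι → ℝ) →ₗ[ℝ] E := ∑ e ∈ A, (LinearMap.proj e : (ι → ℝ) →ₗ[ℝ] ℝ).smulRight (a e) with hL
  have : zonotope A a c = L '' Set.Icc 0 fun e => (c e : ℝ) := by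
    simp [zonotope, hL]
  rw [this]
  exact (convex_Icc (𝕜 := ℝ) (0 : ι → ℝ) _).linear_image L

theorem convex_originSegment (c : ℝ≥0) (v : E) : Convex ℝ (originSegment c v) :=
  (convex_Icc _ _).linear_image (LinearMap.toSpanSingleton ℝ E v)

/-- Substituting c − τ for τ reverses the segment up to a translation, so volumes do not see the
direction of an edge. -/
theorem add_originSegment_neg (C : Set E) (c : ℝ≥0) (v : E) :
    C + originSegment c (-v) = (fun z => z + -((c : ℝ) • v)) '' (C + originSegment c v) := by
  ext z
  simp only [originSegment, Set.mem_add, Set.mem_image]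
  constructor
  · rintro ⟨z, hz, _, ⟨τ, hτ, rfl⟩, rfl⟩
    refine ⟨_, ⟨z, hz, _, ⟨c - τ, ⟨by linarith [hτ.2], by linarith [hτ.1]⟩, rfl⟩, rfl⟩, ?_⟩
    module
  · rintro ⟨_, ⟨z, hz, _, ⟨τ, hτ, rfl⟩, rfl⟩, rfl⟩
    refine ⟨z, hz, _, ⟨c - τ, ⟨by linarith [hτ.2], by linarith [hτ.1]⟩, rfl⟩, ?_⟩
    module

variable [TopologicalSpace E] [ContinuousSMul ℝ E]

theorem isCompact_zonotope [ContinuousAdd E] (A : Finset ι) (a : ι → E) (c : ι → ℝ≥0) :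
    IsCompact (zonotope A a c) :=
  isCompact_Icc.image (by fun_prop)

theorem isCompact_originSegment (c : ℝ≥0) (v : E) : IsCompact (originSegment c v) :=
  isCompact_Icc.image (by fun_prop)

end Basic

/-- The fibrewise case of Cavalieri: `J` is a compact interval. An empty fibre would gain nothing,
which is why the shadow of the body enters the volume formula. -/
theorem volume_add_Icc {J : Set ℝ} (hJ : IsCompact J) (hJ' : Convex ℝ J) (hne : J.Nonempty)
    (c : ℝ≥0) : volume (J + Set.Icc 0 (c : ℝ)) = volume J + c := by
  have h := eq_Icc_of_connected_compact ⟨hne, hJ'.isPreconnected⟩ hJ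
  have hle : sInf J ≤ sSup J := by
    obtain ⟨r, hr⟩ := hne
    rw [h] at hr
    exact hr.1.trans hr.2
  rw [h, Set.Icc_add_Icc hle c.coe_nonneg, Real.volume_Icc, Real.volume_Icc, ← ENNReal.ofReal_coe_nnreal,
    ← ENNReal.ofReal_add (by linarith) c.coe_nonneg]
  congr 1
  ring

variable {n : ℕ}

theorem volume_eq_lintegral_insertNth (i : Fin (n + 1)) {B : Set (Fin (n + 1) → ℝ)}
    (hB : MeasurableSet B) :
    volume B = ∫⁻ y : Fin n → ℝ, volume {r : ℝ | i.insertNth r y ∈ B} := by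
  set φ := MeasurableEquiv.piFinSuccAbove (fun _ : Fin (n + 1) => ℝ) i
  have h := (volume_preserving_piFinSuccAbove (fun _ : Fin (n + 1) => ℝ) i).measure_preimage_equiv
    (φ.symm ⁻¹' B)
  rw [← Set.preimage_comp, MeasurableEquiv.symm_comp_self, Set.preimage_id] at h
  rw [h, Measure.volume_eq_prod, Measure.prod_apply_symm (φ.symm.measurable hB)]
  rfl

/-- Cavalieri's principle for a convex body that is extended along a coordinate axis. -/
theorem volume_add_originSegment_single (i : Fin (n + 1)) {C : Set (Fin (n + 1) → ℝ)}
    (hC : IsCompact C) (hC' : Convex ℝ C) (c : ℝ≥0) :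
    volume (C + originSegment c (Pi.single i 1)) =
      volume C + c * volume (LinearMap.funLeft ℝ ℝ i.succAbove '' C) := by
  set P := LinearMap.funLeft ℝ ℝ i.succAbove with hP
  have hPc : IsCompact (P '' C) := hC.image (LinearMap.continuous_of_finiteDimensional _)
  have hins : ∀ (r τ : ℝ) (y : Fin n → ℝ), (i.insertNth (r + τ) y : Fin (n + 1) → ℝ) =
      i.insertNth r y + τ • Pi.single i 1 := by
    intro r τ y
    ext j
    refine Fin.succAboveCases i ?_ (fun j => ?_) j <;> simp
  have hline : ∀ (r : ℝ) (y : Fin n → ℝ), (i.insertNth r y : Fin (n + 1) → ℝ) =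
      i.insertNth 0 y + r • Pi.single i 1 := fun r y => by rw [← hins, zero_add]
  have hcl : ∀ y : Fin n → ℝ, IsCompact {r : ℝ | i.insertNth r y ∈ C} := by
    intro y
    refine (hC.image (continuous_apply i)).of_isClosed_subset ?_ ?_
    · have : {r : ℝ | i.insertNth r y ∈ C} =
          (fun r : ℝ => (i.insertNth 0 y : Fin (n + 1) → ℝ) + r • Pi.single i 1) ⁻¹' C := by
        ext r
        rw [Set.mem_ofPred_eq, hline, Set.mem_preimage]
      rw [this]
      exact hC.isClosed.preimage (by fun_prop)
    · intro r hr
      exact ⟨_, hr, by simp⟩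
  have hcv : ∀ y : Fin n → ℝ, Convex ℝ {r : ℝ | i.insertNth r y ∈ C} := by
    intro y r hr r' hr' a b ha hb hab
    have := hC' hr hr' ha hb hab
    simp only [Set.mem_ofPred_eq]
    convert this using 1
    rw [hline, hline r, hline r']
    simp only [smul_eq_mul]
    have h1 : (i.insertNth 0 y : Fin (n + 1) → ℝ) = (a + b) • i.insertNth 0 y := by
      rw [hab, one_smul]
    conv_lhs => rw [h1]
    module
  have hslice : ∀ y : Fin n → ℝ,
      {r : ℝ | i.insertNth r y ∈ C + originSegment c (Pi.single i 1)} =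
        {r : ℝ | i.insertNth r y ∈ C} + Set.Icc 0 (c : ℝ) := by
    intro y
    ext r
    simp only [Set.mem_ofPred_eq, Set.mem_add, originSegment, Set.mem_image]
    constructor
    · rintro ⟨z, hz, _, ⟨τ, hτ, rfl⟩, h⟩
      refine ⟨r - τ, ?_, τ, hτ, by ring⟩
      have h2 := hins (r - τ) τ y
      rw [sub_add_cancel, ← h] at h2
      rwa [← add_right_cancel h2]
    · rintro ⟨r, hr, τ, hτ, rfl⟩
      exact ⟨_, hr, _, ⟨τ, hτ, rfl⟩, (hins r τ y).symm⟩
  have hmem : ∀ y : Fin n → ℝ, y ∈ P '' C ↔ {r : ℝ | i.insertNth r y ∈ C}.Nonempty := by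
    intro y
    constructor
    · rintro ⟨z, hz, rfl⟩
      refine ⟨z i, ?_⟩
      have : (i.insertNth (z i) (P z) : Fin (n + 1) → ℝ) = z := by
        ext j
        refine Fin.succAboveCases i ?_ (fun j => ?_) j <;> simp [hP, LinearMap.funLeft_apply]
      rwa [Set.mem_ofPred_eq, this]
    · rintro ⟨r, hr⟩
      exact ⟨_, hr, by ext j; simp [hP, LinearMap.funLeft_apply]⟩
  have hU : IsCompact (C + originSegment c (Pi.single i (1 : ℝ))) :=
    hC.add (isCompact_originSegment _ _)
  rw [volume_eq_lintegral_insertNth i hU.measurableSet,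
    volume_eq_lintegral_insertNth i hC.measurableSet,
    ← lintegral_indicator_const hPc.measurableSet,
    ← lintegral_add_right _ (measurable_const.indicator hPc.measurableSet)]
  refine lintegral_congr fun y => ?_
  rw [hslice]
  -- Lines over the shadow `P '' C` gain exactly `c`; all others miss both bodies.
  by_cases hy : y ∈ P '' C
  · rw [Set.indicator_of_mem hy, volume_add_Icc (hcl y) (hcv y) ((hmem y).1 hy)]
  · have : {r : ℝ | i.insertNth r y ∈ C} = ∅ :=
      Set.not_nonempty_iff_eq_empty.1 fun h => hy ((hmem y).2 h)
    rw [Set.indicator_of_notMem hy, this]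
    simp

/-- Dropping coordinate `i` merges vertex `i` with the origin: `finSuccEquiv' i` sends `i` to
`none`. -/
theorem funLeft_succAbove_node (i : Fin (n + 1)) (o : Option (Fin (n + 1))) :
    LinearMap.funLeft ℝ ℝ i.succAbove (node o) = node (o.bind (finSuccEquiv' i)) := by
  ext j
  rcases o with _ | l
  · simp [node, LinearMap.funLeft_apply]
  · refine Fin.succAboveCases i ?_ (fun l => ?_) l
    · simp [node, LinearMap.funLeft_apply]
    · simp [node, LinearMap.funLeft_apply, Pi.single_apply]

/-- The effect on vertices of projecting along the edge from `b` to `i`: vertex `i` goes where `b`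
goes, and the remaining vertices stay distinct. -/
theorem identifies_contract {i : Fin (n + 1)} {b : Option (Fin (n + 1))} (hb : b ≠ some i) :
    Identifies (fun o => if o = some i then b.bind (finSuccEquiv' i)
      else o.bind (finSuccEquiv' i)) (some i) b := by
  have hinj : ∀ o o' : Option (Fin (n + 1)), o ≠ some i → o' ≠ some i →
      (o.bind (finSuccEquiv' i) = o'.bind (finSuccEquiv' i) ↔ o = o') := by
    intro o o' ho ho'
    refine ⟨fun h => ?_, fun h => by rw [h]⟩
    rcases o with _ | l <;> rcases o' with _ | l'
    · rfl
    · refine absurd h.symm fun h => ho' ?_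
      have : finSuccEquiv' i l' = none := h
      rw [← finSuccEquiv'_at i] at this
      rw [(finSuccEquiv' i).injective this]
    · refine absurd h fun h => ho ?_
      have : finSuccEquiv' i l = none := h
      rw [← finSuccEquiv'_at i] at this
      rw [(finSuccEquiv' i).injective this]
    · exact congrArg some ((finSuccEquiv' i).injective h)
  constructor
  · rintro (_ | j)
    · exact ⟨none, by simp⟩
    · exact ⟨some (i.succAbove j), by simp [Fin.succAbove_ne]⟩
  · intro o o'
    by_cases ho : o = some i <;> by_cases ho' : o' = some i
    · simp [ho, ho']
    · simp only [ho, ho', if_true, if_false, hinj b o' hb ho']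
      have := Ne.symm ho'
      tauto
    · simp only [ho, ho', if_true, if_false, hinj o b ho hb]
      tauto
    · simp only [ho, ho', if_false, hinj o o' ho ho']
      tauto

/-- The shear z ↦ z + zᵢ · `node b` has determinant 1, because `node b` vanishes at `i`, and it
turns the edge vector into the `i`-th basis vector. This reduces the claim to extension along a
coordinate axis. -/
theorem volume_add_originSegment_node (i : Fin (n + 1)) {b : Option (Fin (n + 1))}
    (hb : b ≠ some i) :
    ∃ (q : Option (Fin (n + 1)) → Option (Fin n)) (P : (Fin (n + 1) → ℝ) →ₗ[ℝ] (Fin n → ℝ)),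
      Identifies q (some i) b ∧ (∀ o, P (node o) = node (q o)) ∧
      ∀ C : Set (Fin (n + 1) → ℝ), IsCompact C → Convex ℝ C → ∀ c : ℝ≥0,
        volume (C + originSegment c (node (some i) - node b)) =
          volume C + c * volume (P '' C) := by
  have hbi : node b i = 0 := by
    rcases b with _ | j
    · rfl
    · have : i ≠ j := fun h => hb (by rw [h])
      simp [node, this]
  set M : (Fin (n + 1) → ℝ) →ₗ[ℝ] (Fin (n + 1) → ℝ) :=
    LinearMap.transvection (LinearMap.proj i) (node b) with hM
  have hMdet : LinearMap.det M = 1 := by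
    rw [hM, LinearMap.transvection.det]
    simp [hbi]
  have hMa : ∀ z, M z = z + z i • node b := fun z => by
    simp [hM, LinearMap.transvection.apply]
  have hvol : ∀ X, volume (M '' X) = volume X := fun X => by
    rw [Measure.addHaar_image_linearMap, hMdet]
    simp
  refine ⟨_, LinearMap.funLeft ℝ ℝ i.succAbove ∘ₗ M, identifies_contract hb, fun o => ?_,
    fun C hC hC' c => ?_⟩
  · rw [LinearMap.comp_apply, hMa, map_add, map_smul, funLeft_succAbove_node,
      funLeft_succAbove_node]
    split_ifs with ho
    · subst ho
      simp [node]
    · have : node o i = 0 := by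
        rcases o with _ | j
        · rfl
        · have : i ≠ j := fun h => ho (by rw [h])
          simp [node, this]
      rw [this, zero_smul, add_zero]
  · have hMe : M (node (some i) - node b) = Pi.single i 1 := by
      rw [hMa]
      simp [node] at hbi ⊢
      simp [hbi]
    rw [← hvol (C + _), Set.image_add, image_originSegment, hMe,
      volume_add_originSegment_single i (hC.image (LinearMap.continuous_of_finiteDimensional _))
        (hC'.linear_image M), hvol, LinearMap.coe_comp, Set.image_comp]

/-- The volume that a convex body gains when it is extended along an edge is the volume of its
projection along this edge. -/
theorem exists_contraction {a b : Option (Fin n)} (hab : a ≠ b) :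
    ∃ (m : ℕ) (q : Option (Fin n) → Option (Fin m)) (P : (Fin n → ℝ) →ₗ[ℝ] (Fin m → ℝ)),
      Identifies q a b ∧ (∀ o, P (node o) = node (q o)) ∧
      ∀ C : Set (Fin n → ℝ), IsCompact C → Convex ℝ C → ∀ c : ℝ≥0,
        volume (C + originSegment c (node a - node b)) = volume C + c * volume (P '' C) := by
  have hn : ∀ i : Fin n, ∃ m, n = m + 1 := fun i => Nat.exists_eq_succ_of_ne_zero (by
    rintro rfl; exact i.elim0)
  rcases a with _ | i
  · rcases b with _ | i
    · exact absurd rfl hab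
    obtain ⟨m, rfl⟩ := hn i
    obtain ⟨q, P, hq, hP, h⟩ := volume_add_originSegment_node i hab
    refine ⟨m, q, P, hq.swap, hP, fun C hC hC' c => ?_⟩
    rw [← neg_sub, add_originSegment_neg, ← h C hC hC' c]
    rw [Set.image_add_right, measure_preimage_add_right]
  · obtain ⟨m, rfl⟩ := hn i
    obtain ⟨q, P, h⟩ := volume_add_originSegment_node i hab.symm
    exact ⟨m, q, P, h⟩

/-- The volume of a graphical zonotope is the weighted number of spanning trees. -/
theorem volume_zonotope {ι : Type*} [DecidableEq ι] (c : ι → ℝ≥0) (A : Finset ι) (n : ℕ)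
    (src tgt : ι → Option (Fin n)) :
    volume (zonotope A (fun e => node (tgt e) - node (src e)) c) =
      treeSum (fun e => s(src e, tgt e)) c A := by
  -- The dimension varies because contracting an edge lowers it.
  induction A using Finset.induction_on generalizing n with
  | empty =>
    have h0 : zonotope (∅ : Finset ι) (fun e => node (tgt e) - node (src e)) c = {0} := by
      simp only [zonotope, Finset.sum_empty]
      exact Set.Nonempty.image_const ⟨0, Set.left_mem_Icc.2 fun e => (c e).2⟩ 0
    rw [h0]
    -- A point has volume 1 in dimension 0 and volume 0 otherwise, just as the empty set is a
    -- spanning tree only for a single vertex.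
    rcases n with _ | n
    · rw [treeSum_empty_of_subsingleton]
      have : ({0} : Set (Fin 0 → ℝ)) = Set.univ :=
        Set.eq_univ_of_forall fun z => Subsingleton.elim _ _
      rw [this]
      simp [volume_pi]
    · rw [treeSum_empty_of_nontrivial]
      simp
  | insert e A he ih =>
    rw [zonotope_insert he]
    by_cases hl : tgt e = src e
    · rw [treeSum_insert_loop he (a := src e) (by rw [hl]), ← ih]
      have : originSegment (c e) (node (tgt e) - node (src e)) = {0} := by
        simp only [hl, sub_self, originSegment, smul_zero]
        exact Set.Nonempty.image_const ⟨0, Set.left_mem_Icc.2 (c e).2⟩ 0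
      rw [this, Set.add_singleton]
      simp
    · obtain ⟨m, q, P, hq, hP, h⟩ := exists_contraction hl
      rw [h _ (isCompact_zonotope _ _ _) (convex_zonotope _ _ _), ih, image_zonotope,
        treeSum_insert he hq hl Sym2.eq_swap]
      simp only [map_sub, hP]
      rw [ih m (fun e => q (src e)) fun e => q (tgt e)]
      push_cast
      rfl

/-- The extra segment acts as a new edge of capacity `k`: deleting it leaves the graph, contracting
it identifies `a` and `b`. Any map `q` that makes this identification gives the same tree sum. -/
theorem volume_zonotope_add_originSegment {ι W : Type*} [DecidableEq ι] (c : ι → ℝ≥0)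
    (A : Finset ι) (src tgt : ι → Option (Fin n)) {a b : Option (Fin n)} (hab : a ≠ b)
    {q : Option (Fin n) → W} (hq : Identifies q a b) (k : ℝ≥0) :
    volume (zonotope A (fun e => node (tgt e) - node (src e)) c +
        originSegment k (node a - node b)) =
      treeSum (fun e => s(src e, tgt e)) c A +
        k * treeSum (fun e => s(src e, tgt e).map q) c A := by
  obtain ⟨m, q', P, hq', hP, h⟩ := exists_contraction hab
  rw [h _ (isCompact_zonotope _ _ _) (convex_zonotope _ _ _), volume_zonotope, image_zonotope,
    hq.treeSum_eq hq' (ends := fun e => s(src e, tgt e))]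
  simp only [map_sub, hP]
  rw [volume_zonotope c A m (fun e => q' (src e)) fun e => q' (tgt e)]
  rfl

end Volume

/-! ### Inclusion–exclusion for a body and its translate, and the equality case -/

section Equality

open scoped Pointwise

/-- The nodes are affinely independent, so a linear functional can take prescribed values on them up
to a common constant. -/
theorem exists_functional {n : ℕ} (h₀ : Option (Fin n) → ℝ) :
    ∃ h : (Fin n → ℝ) →ₗ[ℝ] ℝ, ∀ a b, h (node a - node b) = h₀ a - h₀ b := by
  refine ⟨Fintype.linearCombination ℝ fun j => h₀ (some j) - h₀ none, ?_⟩
  have : ∀ a, Fintype.linearCombination ℝ (fun j => h₀ (some j) - h₀ none) (node a) =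
      h₀ a - h₀ none := by
    rintro (_ | j)
    · simp [node]
    · rw [node, Option.elim_some, Fintype.linearCombination_apply_single, one_smul]
  intro a b
  rw [map_sub, this, this]
  ring

/-- Up to the pair `x`, `y`, a function on a finite set can separate all points. -/
theorem exists_separating_identification {W : Type*} [Finite W] (x y : W) :
    ∃ h₀ : W → ℝ, h₀ x = h₀ y ∧
      ∀ a b, a ≠ b → h₀ a = h₀ b → (a = x ∧ b = y) ∨ (a = y ∧ b = x) := by
  classical
  obtain ⟨j, hj⟩ := Countable.exists_injective_nat W
  refine ⟨fun w => if w = y then j x else j w, by simp, fun a b hab h => ?_⟩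
  by_cases ha : a = y <;> by_cases hb : b = y
  · exact absurd (ha.trans hb.symm) hab
  · simp only [ha, hb, if_true, if_false, Nat.cast_inj] at h
    exact .inr ⟨ha, (hj h).symm⟩
  · simp only [ha, hb, if_true, if_false, Nat.cast_inj] at h
    exact .inl ⟨hj h, hb⟩
  · simp only [ha, hb, if_false, Nat.cast_inj] at h
    exact absurd (hj h) hab

variable {ι W E : Type*} [Fintype ι] [AddCommGroup E] [Module ℝ E]

/-- If the zonotope and its translate cover the zonotope that is extended along `ψ x - ψ y`, then
there is an edge between `x` and `y` that is at least as long as the translation. -/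
theorem exists_edge_of_cover [Finite W] {ψ : W → E}
    (hψ : ∀ h₀ : W → ℝ, ∃ h : E →ₗ[ℝ] ℝ, ∀ a b, h (ψ a - ψ b) = h₀ a - h₀ b)
    {src tgt : ι → W} (hne : ∀ e, src e ≠ tgt e)
    (hinj : Function.Injective fun e => s(src e, tgt e)) (c : ι → ℝ≥0) {x y : W} (hxy : x ≠ y)
    {k : ℝ≥0} (hk : 0 < k)
    (hcov : zonotope Finset.univ (fun e => ψ (tgt e) - ψ (src e)) c +
        originSegment k (ψ x - ψ y) ⊆
      zonotope Finset.univ (fun e => ψ (tgt e) - ψ (src e)) c ∪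
        (zonotope Finset.univ (fun e => ψ (tgt e) - ψ (src e)) c + {(k : ℝ) • (ψ x - ψ y)})) :
    ∃ e, s(src e, tgt e) = s(x, y) ∧ k ≤ c e := by
  classical
  by_contra! hcon
  obtain ⟨h₀, h₀xy, h₀inj⟩ := exists_separating_identification x y
  obtain ⟨h, hh⟩ := hψ h₀
  have hd : ψ x - ψ y ≠ 0 := by
    intro h0
    obtain ⟨h', hh'⟩ := hψ (Pi.single x 1)
    have := hh' x y
    rw [h0, map_zero] at this
    simp [hxy.symm] at this
  have hhd : h (ψ x - ψ y) = 0 := by rw [hh, h₀xy, sub_self]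
  set a : ι → E := fun e => ψ (tgt e) - ψ (src e) with ha
  set Z := zonotope Finset.univ a c with hZ
  have hzero : ∀ e, h (a e) = 0 → (src e = x ∧ tgt e = y) ∨ (src e = y ∧ tgt e = x) := by
    intro e he
    rw [ha, hh, sub_eq_zero] at he
    exact h₀inj _ _ (hne e) he.symm
  -- An end of the face of `Z` where `h` is maximal. An edge directed from `x` to `y` has vector −(ψ
  -- x − ψ y), so it is filled in order that the face extends from `z₀` in the direction +(ψ x − ψ
  -- y).
  let t₀ : ι → ℝ := fun e => if 0 < h (a e) ∨ (src e = x ∧ tgt e = y) then c e else 0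
  have ht₀ : t₀ ∈ Set.Icc 0 fun e => (c e : ℝ) := by
    constructor <;> intro e <;> simp only [t₀] <;> split_ifs <;> simp
  set z₀ := ∑ e, t₀ e • a e with hz₀
  have hz₀Z : z₀ ∈ Z := ⟨t₀, ht₀, rfl⟩
  -- By maximality no edge can lower the value of `h`, so every coordinate on which `h` depends is
  -- forced.
  have hface : ∀ t ∈ Set.Icc 0 fun e => (c e : ℝ), h (∑ e, t e • a e) = h z₀ →
      ∀ e, h (a e) ≠ 0 → t e = t₀ e := by
    intro t ht htz
    have hnn : ∀ e ∈ Finset.univ, 0 ≤ (t₀ e - t e) * h (a e) := by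
      intro e _
      have h1 := ht.1 e
      have h2 := ht.2 e
      simp only [Pi.zero_apply] at h1 h2
      by_cases hp : 0 < h (a e)
      · simp only [t₀, hp, true_or, if_true]
        exact mul_nonneg (by linarith) hp.le
      · by_cases hz : h (a e) = 0
        · rw [hz, mul_zero]
        · have hne' : ¬ (src e = x ∧ tgt e = y) := by
            rintro ⟨h1, h2⟩
            apply hz
            rw [ha, hh, h1, h2, h₀xy, sub_self]
          simp only [t₀, hp, hne', or_self, if_false]
          exact mul_nonneg_of_nonpos_of_nonpos (by linarith) (not_lt.1 hp)
    have hsum : ∑ e, (t₀ e - t e) * h (a e) = 0 := by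
      simp only [hz₀, map_sum, map_smul, smul_eq_mul] at htz
      simp only [sub_mul, Finset.sum_sub_distrib, htz, sub_self]
    intro e he
    have := (Finset.sum_eq_zero_iff_of_nonneg hnn).1 hsum e (Finset.mem_univ e)
    rcases mul_eq_zero.1 this with h | h
    · linarith
    · exact absurd h he
  -- Only an edge between `x` and `y` is still free on the face; `κ₀` is its capacity, or 0 if there
  -- is no such edge.
  have hline : ∃ κ₀ : ℝ, 0 ≤ κ₀ ∧ κ₀ < k ∧ ∀ z ∈ Z, h z = h z₀ →
      ∃ κ : ℝ, 0 ≤ κ ∧ κ ≤ κ₀ ∧ z = z₀ + κ • (ψ x - ψ y) := by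
    by_cases hex : ∃ e₀, s(src e₀, tgt e₀) = s(x, y)
    · obtain ⟨e₀, he₀⟩ := hex
      refine ⟨c e₀, (c e₀).2, hcon e₀ he₀, ?_⟩
      rintro _ ⟨t, ht, rfl⟩ htz
      have hz : ∑ e, t e • a e - z₀ = (t e₀ - t₀ e₀) • a e₀ := by
        rw [hz₀, ← Finset.sum_sub_distrib]
        simp only [← sub_smul]
        refine Finset.sum_eq_single e₀ (fun e _ hee => ?_) (by simp)
        have : h (a e) ≠ 0 := by
          intro h0
          apply hee
          apply hinj
          simp only [he₀, Sym2.eq_iff]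
          exact hzero e h0
        rw [hface t ht htz e this, sub_self, zero_smul]
      have h1 := ht.1 e₀
      have h2 := ht.2 e₀
      simp only [Pi.zero_apply] at h1 h2
      have h0 : ¬ 0 < h (a e₀) := by
        rcases Sym2.eq_iff.1 he₀ with ⟨hs, ht⟩ | ⟨hs, ht⟩ <;> simp [ha, hh, hs, ht, h₀xy]
      rw [sub_eq_iff_eq_add'] at hz
      dsimp only
      rw [hz]
      rcases Sym2.eq_iff.1 he₀ with ⟨hs, ht⟩ | ⟨hs, ht⟩
      · refine ⟨c e₀ - t e₀, by linarith, by linarith, ?_⟩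
        simp only [t₀, ha, hs, ht, and_self, or_true, if_true]
        module
      · refine ⟨t e₀, h1, h2, ?_⟩
        have : t₀ e₀ = 0 := by simp [t₀, h0, hs, hxy.symm]
        rw [this, ha]
        simp [hs, ht]
    · refine ⟨0, le_rfl, by exact_mod_cast hk, ?_⟩
      rintro _ ⟨t, ht, rfl⟩ htz
      refine ⟨0, le_rfl, le_rfl, ?_⟩
      rw [zero_smul, add_zero, hz₀]
      refine Finset.sum_congr rfl fun e _ => ?_
      rw [hface t ht htz e fun h0 => hex ⟨e, Sym2.eq_iff.2 (hzero e h0)⟩]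
  obtain ⟨κ₀, hκ₀, hκk, hline⟩ := hline
  -- The point at parameter `τ` lies beyond the face of `Z`, since τ > κ₀, and before the face of
  -- the translate, since τ < k.
  set τ := (κ₀ + k) / 2 with hτ
  have hu : z₀ + τ • (ψ x - ψ y) ∈ Z + originSegment k (ψ x - ψ y) :=
    ⟨z₀, hz₀Z, _, ⟨τ, ⟨by linarith, by linarith⟩, rfl⟩, rfl⟩
  rcases hcov hu with hu | ⟨z, hz, _, rfl, hu⟩
  · obtain ⟨κ, h1, h2, h3⟩ := hline _ hu (by rw [map_add, map_smul, hhd, smul_zero, add_zero])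
    have := smul_left_injective ℝ hd (add_left_cancel h3)
    linarith
  · have hz' : z = z₀ + (τ - k) • (ψ x - ψ y) := by
      dsimp only at hu
      rw [eq_sub_of_add_eq hu]
      module
    obtain ⟨κ, h1, h2, h3⟩ := hline _ hz (by
      rw [hz', map_add, map_smul, hhd, smul_zero, add_zero])
    rw [hz'] at h3
    have := smul_left_injective ℝ hd (add_left_cancel h3)
    linarith

/-- The coordinate of `e₀` absorbs a shift by τ. If this leaves [0, c(e₀)], a shift by τ − k stays
inside because k ≤ c(e₀), and the point lies in the translate. -/
theorem cover_of_edge {ψ : W → E} {src tgt : ι → W} {c : ι → ℝ≥0} {x y : W} {k : ℝ≥0} {e₀ : ι}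
    (he₀ : s(src e₀, tgt e₀) = s(x, y)) (hk : k ≤ c e₀) :
    zonotope Finset.univ (fun e => ψ (tgt e) - ψ (src e)) c + originSegment k (ψ x - ψ y) ⊆
      zonotope Finset.univ (fun e => ψ (tgt e) - ψ (src e)) c ∪
        (zonotope Finset.univ (fun e => ψ (tgt e) - ψ (src e)) c + {(k : ℝ) • (ψ x - ψ y)}) := by
  classical
  set a : ι → E := fun e => ψ (tgt e) - ψ (src e) with ha
  have hk' : (k : ℝ) ≤ c e₀ := hk
  have hmem : ∀ t ∈ Set.Icc 0 fun e => (c e : ℝ), ∀ r : ℝ, 0 ≤ t e₀ + r → t e₀ + r ≤ c e₀ →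
      ∑ e, t e • a e + r • a e₀ ∈ zonotope Finset.univ a c := by
    intro t ht r h1 h2
    refine ⟨t + Pi.single e₀ r, ⟨fun e => ?_, fun e => ?_⟩, ?_⟩
    · by_cases he : e = e₀
      · subst he; simpa using h1
      · simpa [he] using ht.1 e
    · by_cases he : e = e₀
      · subst he; simpa using h2
      · simpa [he] using ht.2 e
    · simp only [Pi.add_apply, add_smul, Finset.sum_add_distrib]
      congr 1
      rw [Finset.sum_eq_single e₀ (fun e _ he => by simp [he]) (by simp), Pi.single_eq_same]
  rintro _ ⟨_, ⟨t, ht, rfl⟩, _, ⟨τ, hτ, rfl⟩, rfl⟩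
  have h1 := ht.1 e₀
  have h2 := ht.2 e₀
  simp only [Pi.zero_apply] at h1 h2
  dsimp only
  rcases Sym2.eq_iff.1 he₀ with ⟨hs', ht'⟩ | ⟨hs', ht'⟩
  · have hd : ψ x - ψ y = (-1 : ℝ) • a e₀ := by simp [ha, hs', ht']
    by_cases hc : 0 ≤ t e₀ - τ
    · left
      convert hmem t ht (-τ) (by linarith) (by linarith [hτ.1]) using 2
      rw [hd]; module
    · right
      refine ⟨_, hmem t ht (k - τ) (by linarith [hτ.2]) (by linarith), _, rfl, ?_⟩
      dsimp only
      rw [hd]; module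
  · have hd : ψ x - ψ y = a e₀ := by simp [ha, hs', ht']
    by_cases hc : t e₀ + τ ≤ c e₀
    · left
      convert hmem t ht τ (by linarith [hτ.1]) hc using 2
      rw [hd]
    · right
      refine ⟨_, hmem t ht (τ - k) (by linarith) (by linarith [hτ.2]), _, rfl, ?_⟩
      dsimp only
      rw [hd]; module

/-- The part of a convex body that stays in it under a translation is at least as large as the
body minus what it gains when it is extended along the translation. -/
theorem volume_inter_translate {n : ℕ} {Z : Set (Fin n → ℝ)} (hZ : IsCompact Z)
    (hZ' : Convex ℝ Z) (hpos : volume.real Z ≠ 0) (k : ℝ≥0) (d : Fin n → ℝ) :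
    2 * volume.real Z - volume.real (Z + originSegment k d) ≤
        volume.real (Z ∩ {z | z + (k : ℝ) • d ∈ Z}) ∧
      (volume.real (Z ∩ {z | z + (k : ℝ) • d ∈ Z}) =
          2 * volume.real Z - volume.real (Z + originSegment k d) ↔
        Z + originSegment k d ⊆ Z ∪ (Z + {(k : ℝ) • d})) := by
  set v := (k : ℝ) • d with hv
  set U := Z + originSegment k d with hU
  have hUc : IsCompact U := hZ.add (isCompact_originSegment _ _)
  have hUv : Convex ℝ U := hZ'.add (convex_originSegment _ _)
  have hTc : IsCompact (Z + {v}) := hZ.add isCompact_singleton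
  have hTvol : volume.real (Z + {v}) = volume.real Z := by
    rw [Measure.real, Set.add_singleton, Set.image_add_right, measure_preimage_add_right]
    rfl
  have hZU : Z ⊆ U := fun z hz => ⟨z, hz, 0, ⟨0, ⟨le_rfl, k.2⟩, zero_smul _ _⟩, add_zero z⟩
  have hTU : Z + {v} ⊆ U := Set.add_subset_add_left (by
    rintro _ rfl
    exact ⟨k, ⟨k.2, le_rfl⟩, rfl⟩)
  have hint : volume.real (Z ∩ {z | z + v ∈ Z}) = volume.real (Z ∩ (Z + {v})) := by
    have : Z ∩ {z | z + v ∈ Z} = (fun z => z + v) ⁻¹' (Z ∩ (Z + {v})) := by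
      ext z
      simp [and_comm]
    rw [this, Measure.real, measure_preimage_add_right]
    rfl
  have hie := measureReal_union_add_inter (μ := volume) (s := Z) hTc.measurableSet
    hZ.measure_ne_top hTc.measure_ne_top
  have hsub : Z ∪ (Z + {v}) ⊆ U := Set.union_subset hZU hTU
  have hle : volume.real (Z ∪ (Z + {v})) ≤ volume.real U := measureReal_mono hsub hUc.measure_ne_top
  have hWc : IsCompact (Z ∪ (Z + {v})) := hZ.union hTc
  rw [hint]
  refine ⟨by linarith, fun h => ?_, fun h => ?_⟩
  · have heq : volume.real (Z ∪ (Z + {v})) = volume.real U := by linarith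
    have hnull : volume (U \ (Z ∪ (Z + {v}))) = 0 := by
      have := measureReal_sdiff (μ := volume) hsub hWc.measurableSet hUc.measure_ne_top
      rw [heq, sub_self, measureReal_eq_zero_iff
        ((measure_mono Set.sdiff_subset).trans_lt hUc.measure_lt_top).ne] at this
      exact this
    -- An open null set is empty. This upgrades equality of volumes to a genuine cover, as `U` lies
    -- in the closure of its interior and the union is closed.
    have hemp : interior U \ (Z ∪ (Z + {v})) = ∅ :=
      (isOpen_interior.sdiff hWc.isClosed).eq_empty_of_measure_zero
        (measure_mono_null (Set.sdiff_subset_sdiff_left interior_subset) hnull)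
    have hne : (interior U).Nonempty := by
      rw [Set.nonempty_iff_ne_empty]
      intro h0
      apply hpos
      rw [measureReal_eq_zero_iff hZ.measure_ne_top]
      -- With empty interior, `U` would lie in its frontier, which is null by convexity.
      refine measure_mono_null (hZU.trans ?_) (hUv.addHaar_frontier volume)
      rw [frontier, h0, Set.sdiff_empty]
      exact subset_closure
    calc U ⊆ closure U := subset_closure
      _ = closure (interior U) := (hUv.closure_interior_eq_closure_of_nonempty_interior hne).symm
      _ ⊆ Z ∪ (Z + {v}) := closure_minimal (Set.sdiff_eq_empty.1 hemp) hWc.isClosed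
  · have heq : volume.real (Z ∪ (Z + {v})) = volume.real U := by rw [hsub.antisymm h]
    linarith

end Equality

/-! ### Potentials, scores of configurations, and flows -/

section Scores

variable {V : Type*} {G : SimpleGraph V} {s : G.Dart → ℤˣ}

theorem walkDir_append {n : ℕ} (D : G.edgeSet → EuclideanSpace ℝ (Fin n)) {u v w : V}
    (p : G.Walk u v) (q : G.Walk v w) :
    walkDir s D (p.append q) = walkDir s D p + walkDir s D q := by
  simp [walkDir]

/-- If closed walks have direction `0`, then the edges are differences of a potential. -/
theorem exists_potential (hG : G.Connected) {n : ℕ} {D : G.edgeSet → EuclideanSpace ℝ (Fin n)}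
    (hD : ∀ (u : V) (p : G.Walk u u), walkDir s D p = 0) :
    ∃ Φ : V → EuclideanSpace ℝ (Fin n),
      ∀ d : G.Dart, ((s d : ℤ) : ℝ) • D (dartEdge d) = Φ d.snd - Φ d.fst := by
  obtain ⟨r⟩ := hG.nonempty
  have hp : ∀ v, Nonempty (G.Walk r v) := fun v => hG.preconnected r v
  have hq : ∀ v, Nonempty (G.Walk v r) := fun v => hG.preconnected v r
  let p := fun v => (hp v).some
  let q := fun v => (hq v).some
  refine ⟨fun v => walkDir s D (p v), fun d => ?_⟩
  -- Two closed walks with the same return path `q d.snd`; comparing them isolates the contribution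
  -- of `d`.
  have h1 := hD r ((p d.fst).append (.cons d.adj (q d.snd)))
  have h2 := hD r ((p d.snd).append (q d.snd))
  rw [walkDir_append] at h1 h2
  have h3 : walkDir s D (.cons d.adj (q d.snd)) =
      ((s d : ℤ) : ℝ) • D (dartEdge d) + walkDir s D (q d.snd) := by
    simp [walkDir]
  rw [h3] at h1
  rw [← add_assoc] at h1
  have h4 := add_right_cancel (h1.trans h2.symm)
  exact eq_sub_of_add_eq' h4

theorem exists_positive_dart (hs : IsOrientation s) (e : G.edgeSet) :
    ∃ d : G.Dart, s d = 1 ∧ dartEdge d = e := by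
  obtain ⟨⟨u, v⟩, he⟩ := e
  let d : G.Dart := ⟨(u, v), he⟩
  rcases Int.units_eq_one_or (s d) with h | h
  · exact ⟨d, h, rfl⟩
  · refine ⟨d.symm, by rw [hs, h, neg_neg], Subtype.ext ?_⟩
    exact d.edge_symm

theorem eq_of_positive (hs : IsOrientation s) {d d' : G.Dart} (h : s d = 1) (h' : s d' = 1)
    (he : dartEdge d = dartEdge d') : d = d' := by
  rcases SimpleGraph.dart_edge_eq_iff d d' |>.1 (congrArg Subtype.val he) with h1 | h1
  · exact h1
  · rw [h1, hs, h'] at h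
    exact absurd h (by decide)

theorem dartEdge_symm (d : G.Dart) : dartEdge d.symm = dartEdge d :=
  Subtype.ext d.edge_symm

theorem identifies_quot_mk {x y : V} :
    Identifies (Quot.mk fun a b : V => a = x ∧ b = y) x y := by
  refine ⟨Quot.mk_surjective, fun a b => ?_⟩
  rw [Quot.eq]
  constructor
  · intro h
    induction h with
    | rel a b h => exact .inr (.inl h)
    | refl a => exact .inl rfl
    | symm a b _ ih => grind
    | trans a b c _ _ ih ih' => grind
  · rintro (rfl | h | ⟨rfl, rfl⟩)
    · exact .refl _
    · exact .rel _ _ h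
    · exact .symm _ _ (.rel _ _ ⟨rfl, rfl⟩)

variable [Fintype V] [DecidableRel G.Adj]

theorem sum_positive {M : Type*} [AddCommMonoid M] (hs : IsOrientation s)
    {pd : G.edgeSet → G.Dart} (hpd : ∀ e, s (pd e) = 1 ∧ dartEdge (pd e) = e) (F : G.Dart → M) :
    ∑ d : G.Dart with s d = 1, F d = ∑ e, F (pd e) := by
  refine Finset.sum_nbij' dartEdge pd (by simp) (by simp [hpd]) ?_ (by simp [hpd]) ?_
  · intro d hd
    exact eq_of_positive hs (hpd _).1 (Finset.mem_filter.1 hd).2 (hpd _).2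
  · intro d hd
    rw [eq_of_positive hs (hpd _).1 (Finset.mem_filter.1 hd).2 (hpd _).2]

variable {M : Type*} [AddCommGroup M] [Module ℝ M]

/-- The score of a configuration for the potential `ψ`. -/
noncomputable def potentialScore (s : G.Dart → ℤˣ) (ψ : V → M) (w : G.Dart → ℝ) : M :=
  ∑ d : G.Dart with s d = 1, w d • (ψ d.snd - ψ d.fst)

/-- A configuration is determined by its values on the positive darts, and these range freely over
the box of capacities. -/
theorem image_potentialScore_config (hs : IsOrientation s) {pd : G.edgeSet → G.Dart}
    (hpd : ∀ e, s (pd e) = 1 ∧ dartEdge (pd e) = e) (c : G.edgeSet → ℝ≥0) (ψ : V → M) :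
    potentialScore s ψ '' {w | IsConfig c w} =
      zonotope Finset.univ (fun e => ψ (pd e).snd - ψ (pd e).fst) c := by
  ext z
  constructor
  · rintro ⟨w, hw, rfl⟩
    refine ⟨fun e => w (pd e), ⟨fun e => hw.1 _, fun e => ?_⟩, ?_⟩
    · have h1 := hw.2 (pd e)
      have h2 := hw.1 (pd e).symm
      rw [(hpd e).2] at h1
      dsimp only
      linarith
    · rw [potentialScore, sum_positive hs hpd]
  · rintro ⟨t, ht, rfl⟩
    have h1 := ht.1
    have h2 := ht.2
    refine ⟨fun d => if s d = 1 then t (dartEdge d) else c (dartEdge d) - t (dartEdge d),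
      ⟨fun d => ?_, fun d => ?_⟩, ?_⟩
    · dsimp only
      split_ifs
      · exact h1 _
      · linarith [h2 (dartEdge d)]
    · rcases Int.units_eq_one_or (s d) with h | h
      · simp [hs d, h, dartEdge_symm]
      · simp [hs d, h, dartEdge_symm]
    · rw [potentialScore, sum_positive hs hpd]
      simp [hpd]

variable [DecidableEq V]

/-- Summation by parts: the total drop of a potential along a flow. -/
theorem sum_flow_smul (hs : IsOrientation s) (f : G.Dart → ℝ) (ψ : V → M) :
    ∑ d : G.Dart with s d = 1, (f d - f d.symm) • (ψ d.fst - ψ d.snd) =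
      ∑ u, ((∑ d : G.Dart with d.fst = u, f d) - ∑ d : G.Dart with d.snd = u, f d) • ψ u := by
  have h1 : ∀ p : G.Dart → V, ∑ d : G.Dart, f d • ψ (p d) =
      ∑ u, (∑ d : G.Dart with p d = u, f d) • ψ u := by
    intro p
    rw [← Finset.sum_fiberwise Finset.univ p]
    refine Finset.sum_congr rfl fun u _ => ?_
    rw [Finset.sum_smul]
    refine Finset.sum_congr rfl fun d hd => ?_
    rw [(Finset.mem_filter.1 hd).2]
  have h2 : ∑ d : G.Dart with ¬ s d = 1, f d • (ψ d.fst - ψ d.snd) =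
      ∑ d : G.Dart with s d = 1, f d.symm • (ψ d.symm.fst - ψ d.symm.snd) := by
    refine Finset.sum_nbij' SimpleGraph.Dart.symm SimpleGraph.Dart.symm ?_ ?_ (by simp) (by simp)
      (by simp)
    · intro d hd
      have := (Int.units_eq_one_or (s d)).resolve_left (Finset.mem_filter.1 hd).2
      simp [hs d, this]
    · intro d hd
      have := (Finset.mem_filter.1 hd).2
      simp only [Finset.mem_filter, Finset.mem_univ, true_and, hs d, this]
      decide
  simp only [sub_smul _ _ (ψ _), Finset.sum_sub_distrib]
  rw [← h1 fun d => d.fst, ← h1 fun d => d.snd, ← Finset.sum_sub_distrib]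
  simp only [← smul_sub]
  rw [← Finset.sum_filter_add_sum_filter_not Finset.univ (fun d : G.Dart => s d = 1), h2,
    ← Finset.sum_add_distrib]
  refine Finset.sum_congr rfl fun d _ => ?_
  simp only [SimpleGraph.Dart.symm_toProd, Prod.fst_swap, Prod.snd_swap]
  module

/-- A transaction succeeds if and only if the score that it leads to is that of a configuration. -/
theorem image_potentialScore_succeeds (hs : IsOrientation s) (c : G.edgeSet → ℝ≥0) {ψ : V → M}
    (hψ : ∀ h₀ : V → ℝ, ∃ h : M →ₗ[ℝ] ℝ, ∀ a b, h (ψ a - ψ b) = h₀ a - h₀ b) (x y : V) (k : ℝ) :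
    potentialScore s ψ '' {w | IsConfig c w ∧ Succeeds w x y k} =
      potentialScore s ψ '' {w | IsConfig c w} ∩
        {z | z + k • (ψ x - ψ y) ∈ potentialScore s ψ '' {w | IsConfig c w}} := by
  have hscore : ∀ (w w' f : G.Dart → ℝ), (∀ d, f d - f d.symm = w d - w' d) →
      potentialScore s ψ w' - potentialScore s ψ w =
        ∑ u, ((∑ d : G.Dart with d.fst = u, f d) - ∑ d : G.Dart with d.snd = u, f d) • ψ u := by
    intro w w' f hf
    rw [← sum_flow_smul hs, potentialScore, potentialScore, ← Finset.sum_sub_distrib]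
    refine Finset.sum_congr rfl fun d _ => ?_
    rw [hf]
    module
  ext z
  constructor
  · rintro ⟨w, ⟨hw, f, ⟨hf0, hf⟩, hfw⟩, rfl⟩
    refine ⟨⟨w, hw, rfl⟩, fun d => w d - f d + f d.symm, ⟨fun d => ?_, fun d => ?_⟩, ?_⟩
    · linarith [hfw d, hf0 d.symm]
    · simp only [← hw.2 d, SimpleGraph.Dart.symm_symm]
      ring
    · rw [← sub_eq_iff_eq_add', hscore w _ f (fun d => by ring)]
      simp only [hf, sub_smul, ite_smul, zero_smul, Finset.sum_sub_distrib, Finset.sum_ite_eq',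
        Finset.mem_univ, if_true, smul_sub]
  · rintro ⟨⟨w, hw, rfl⟩, w', hw', hww'⟩
    -- The positive part of w − w' carries exactly the net change between the configurations, and it
    -- is at most w because w' ≥ 0.
    refine ⟨w, ⟨hw, fun d => max (w d - w' d) 0, ⟨fun d => le_max_right _ _, ?_⟩, fun d => ?_⟩, rfl⟩
    · have hfd : ∀ d : G.Dart, max (w d - w' d) 0 - max (w d.symm - w' d.symm) 0 = w d - w' d := by
        intro d
        have : w d.symm - w' d.symm = -(w d - w' d) := by linarith [hw.2 d, hw'.2 d]
        rw [this]
        exact max_zero_sub_max_neg_zero_eq_self _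
      set f : G.Dart → ℝ := fun d => max (w d - w' d) 0 with hf
      have h1 := hscore w w' f hfd
      rw [hww', add_sub_cancel_left] at h1
      -- The divergences sum to zero, so `ψ` may be replaced by its differences to ψ x; the
      -- functional `h` below then reads off the divergence at `u`.
      have h2 := sum_flow_smul hs f (fun _ => (1 : ℝ))
      simp only [sub_self, mul_zero, Finset.sum_const_zero, smul_eq_mul, mul_one] at h2
      intro u
      set N : V → ℝ := fun u =>
        (∑ d : G.Dart with d.fst = u, f d) - ∑ d : G.Dart with d.snd = u, f d with hN
      change N u = _
      obtain ⟨h, hh⟩ := hψ (Pi.single u 1)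
      have h3 : ∑ a, N a • ψ a = ∑ a, N a • (ψ a - ψ x) := by
        simp only [smul_sub, Finset.sum_sub_distrib, ← Finset.sum_smul]
        rw [← h2, zero_smul, sub_zero]
      have h4 := congrArg h (h1.trans h3)
      simp only [map_smul, map_sum, hh, smul_eq_mul, mul_sub, Finset.sum_sub_distrib,
        ← Finset.sum_mul] at h4
      rw [← h2] at h4
      simp only [Pi.single_apply, mul_ite, mul_one, mul_zero, Finset.sum_ite_eq', Finset.mem_univ,
        if_true, ite_self, sub_zero] at h4
      rw [← h4]
      simp only [@eq_comm _ x u, @eq_comm _ y u]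
    · exact max_le (by linarith [hw'.1 d]) (hw.1 d)

/-- The factor is |det Λ| in coordinates; only its being nonzero matters, since it cancels in the
success probability. -/
theorem linearEquiv_volume_real {n : ℕ} (Λ : (Fin n → ℝ) ≃ₗ[ℝ] EuclideanSpace ℝ (Fin n)) :
    ∃ K : ℝ, K ≠ 0 ∧ ∀ X : Set (Fin n → ℝ), volume.real (Λ '' X) = K * volume.real X := by
  set L := Λ.trans (WithLp.linearEquiv 2 ℝ (Fin n → ℝ)) with hL
  refine ⟨|LinearMap.det (L : (Fin n → ℝ) →ₗ[ℝ] (Fin n → ℝ))|,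
    abs_ne_zero.2 L.isUnit_det'.ne_zero, fun X => ?_⟩
  have h1 := (EuclideanSpace.volume_preserving_symm_measurableEquiv_toLp
    (Fin n)).measure_preimage_equiv (L '' X)
  have h2 : (MeasurableEquiv.toLp 2 (Fin n → ℝ)).symm ⁻¹' (L '' X) = Λ '' X := by
    ext z
    constructor
    · rintro ⟨t, ht, h⟩
      exact ⟨t, ht, (WithLp.linearEquiv 2 ℝ (Fin n → ℝ)).injective h⟩
    · rintro ⟨t, ht, rfl⟩
      exact ⟨t, ht, rfl⟩
  rw [h2] at h1
  have h3 := Measure.addHaar_image_linearMap volume (L : (Fin n → ℝ) →ₗ[ℝ] (Fin n → ℝ)) X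
  rw [Measure.real, h1]
  change volume (L '' X) = _ at h3
  rw [h3, ENNReal.toReal_mul, ENNReal.toReal_ofReal (abs_nonneg _)]
  rfl

/-- In suitable coordinates, the vertices of a spanning representation are the origin and the
standard basis vectors. -/
theorem exists_score_eq (hG : G.Connected) {n : ℕ} (g : V ≃ Option (Fin n))
    {D : G.edgeSet → EuclideanSpace ℝ (Fin n)} (hs : IsOrientation s)
    (hD : ∀ (u : V) (p : G.Walk u u), walkDir s D p = 0)
    (hspan : Submodule.span ℝ (Set.range D) = ⊤) :
    ∃ Λ : (Fin n → ℝ) ≃ₗ[ℝ] EuclideanSpace ℝ (Fin n),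
      ∀ w, score s D w = Λ (potentialScore s (fun v => node (g v)) w) := by
  obtain ⟨Φ, hΦ⟩ := exists_potential hG hD
  set L := Fintype.linearCombination ℝ fun j => Φ (g.symm (some j)) - Φ (g.symm none) with hL
  have hLn : ∀ v, L (node (g v)) = Φ v - Φ (g.symm none) := by
    intro v
    obtain ⟨o, rfl⟩ := g.symm.surjective v
    rw [g.apply_symm_apply]
    rcases o with _ | j
    · simp [node]
    · rw [hL, node, Option.elim_some, Fintype.linearCombination_apply_single, one_smul]
  have hLd : ∀ d : G.Dart, ((s d : ℤ) : ℝ) • D (dartEdge d) =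
      L (node (g d.snd) - node (g d.fst)) := by
    intro d
    rw [hΦ, map_sub, hLn, hLn]
    abel
  -- The span condition enters here; injectivity follows by equality of dimensions.
  have hsurj : Function.Surjective L := by
    rw [← LinearMap.range_eq_top, eq_top_iff, ← hspan, Submodule.span_le]
    rintro _ ⟨e, rfl⟩
    obtain ⟨d, hd, rfl⟩ := exists_positive_dart hs e
    have := hLd d
    rw [hd] at this
    exact ⟨node (g d.snd) - node (g d.fst), by simpa using this.symm⟩
  have hinj : Function.Injective L :=
    (LinearMap.injective_iff_surjective_of_finrank_eq_finrank (by simp)).2 hsurj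
  refine ⟨LinearEquiv.ofBijective L ⟨hinj, hsurj⟩, fun w => ?_⟩
  rw [score, potentialScore, map_sum]
  refine Finset.sum_congr rfl fun d hd => ?_
  have := hLd d
  rw [(Finset.mem_filter.1 hd).2] at this
  rw [map_smul]
  congr 1
  simp only [Units.val_one, Int.cast_one, one_smul] at this
  exact this

open scoped Pointwise in
theorem successProb_bound {n : ℕ} (g : V ≃ Option (Fin n)) (hG : G.Connected)
    (c : G.edgeSet → ℝ≥0) (hc : Gam G c ≠ 0) (hs : IsOrientation s)
    (D : G.edgeSet → EuclideanSpace ℝ (Fin n)) (hD : IsSpanningRep s D)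
    (x y : V) (hxy : x ≠ y) (k : ℝ) (hk : 0 < k) :
    1 - k * GamIdent G c x y / Gam G c ≤ successProb s D c x y k ∧
      (successProb s D c x y k = 1 - k * GamIdent G c x y / Gam G c ↔
        ∃ h : G.Adj x y, k ≤ (c ⟨s(x, y), h⟩ : ℝ)) := by
  lift k to ℝ≥0 using hk.le
  choose pd hpd using exists_positive_dart hs
  have hGam : Gam G c = treeSum (graphEnds G) c Finset.univ := eval_genPoly _ _
  have hGamI : GamIdent G c x y = treeSum (identEnds G x y) c Finset.univ := eval_genPoly _ _
  -- A nonzero Γ(c) has a nonzero summand, hence there is a spanning tree to which the span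
  -- condition applies.
  have hspan : Submodule.span ℝ (Set.range D) = ⊤ := by
    obtain ⟨T, hT⟩ : ∃ T : Finset G.edgeSet, IsSpanningTree (graphEnds G) T := by
      by_contra! hno
      exact hc (by rw [hGam]; simp [treeSum, hno])
    have := hD.2 T (by convert hT)
    exact top_unique (this ▸ Submodule.span_mono (Set.image_subset_range _ _))
  obtain ⟨Λ, hΛ⟩ := exists_score_eq hG g hs (fun u p => (hD.1 u u p).2 rfl) hspan
  obtain ⟨K, hK, hKvol⟩ := linearEquiv_volume_real Λ
  set ψ : V → Fin n → ℝ := fun v => node (g v) with hψ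
  have hψf : ∀ h₀ : V → ℝ, ∃ h : (Fin n → ℝ) →ₗ[ℝ] ℝ, ∀ a b, h (ψ a - ψ b) = h₀ a - h₀ b := by
    intro h₀
    obtain ⟨h, hh⟩ := exists_functional (h₀ ∘ g.symm)
    exact ⟨h, fun a b => by simp [hψ, hh]⟩
  set Z := zonotope Finset.univ (fun e => ψ (pd e).snd - ψ (pd e).fst) c with hZ
  have hends : ∀ e, s((pd e).fst, (pd e).snd) = e.1 := fun e => congrArg Subtype.val (hpd e).2
  have hne : ∀ e, (pd e).fst ≠ (pd e).snd := fun e => (pd e).adj.ne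
  have hinj : Function.Injective fun e : G.edgeSet => s((pd e).fst, (pd e).snd) := by
    simp only [hends]
    exact Subtype.val_injective
  have hZvol : volume.real Z = Gam G c := by
    rw [Measure.real, hZ, hψ, volume_zonotope c Finset.univ n (fun e => g (pd e).fst)
      (fun e => g (pd e).snd), hGam, ← treeSum_map_equiv g]
    simp only [graphEnds, ← hends]
    rfl
  have hq : Identifies (fun o => (Quot.mk _ (g.symm o) : Quot fun a b : V => a = x ∧ b = y))
      (g x) (g y) := by
    refine ⟨Quot.mk_surjective.comp g.symm.surjective, fun a b => ?_⟩
    rw [identifies_quot_mk.eq_iff]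
    simp only [g.symm.injective.eq_iff, Equiv.symm_apply_eq]
  have hUvol : volume.real (Z + originSegment k (ψ x - ψ y)) =
      Gam G c + k * GamIdent G c x y := by
    rw [Measure.real, hZ, hψ, volume_zonotope_add_originSegment c Finset.univ
      (fun e => g (pd e).fst) (fun e => g (pd e).snd) (g.injective.ne hxy) hq, hGam, hGamI,
      ← treeSum_map_equiv g]
    have hI : identEnds G x y = fun e =>
        s(Quot.mk (fun a b : V => a = x ∧ b = y) (pd e).fst, Quot.mk _ (pd e).snd) := by
      funext e
      rw [identEnds, ← hends, Sym2.map_mk]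
    simp only [hI, graphEnds, ← hends, Sym2.map_mk, Equiv.symm_apply_apply]
    rw [← ENNReal.coe_mul, ← ENNReal.coe_add, ENNReal.coe_toReal, NNReal.coe_add, NNReal.coe_mul]
  have himg : ∀ X, score s D '' X = Λ '' (potentialScore s ψ '' X) := fun X => by
    rw [Set.image_image]
    exact Set.image_congr fun w _ => hΛ w
  have hprob : successProb s D c x y k =
      volume.real (Z ∩ {z | z + (k : ℝ) • (ψ x - ψ y) ∈ Z}) / Gam G c := by
    rw [successProb, himg, himg, hKvol, hKvol, image_potentialScore_succeeds hs c hψf,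
      image_potentialScore_config hs hpd, ← hZ, hZvol, mul_div_mul_left _ _ hK]
  obtain ⟨hle, heq⟩ := volume_inter_translate (isCompact_zonotope _ _ _) (convex_zonotope _ _ _)
    (hZvol.trans_ne hc) k (ψ x - ψ y)
  rw [← hZ, hZvol, hUvol] at hle heq
  have hpos : 0 < Gam G c := lt_of_le_of_ne (hGam ▸ NNReal.coe_nonneg _) hc.symm
  have hrw : 1 - k * GamIdent G c x y / Gam G c =
      (2 * Gam G c - (Gam G c + k * GamIdent G c x y)) / Gam G c := by
    field_simp
    ring
  rw [hprob, hrw, div_left_inj' hc, heq]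
  refine ⟨div_le_div_of_nonneg_right hle hpos.le, fun h => ?_, fun ⟨h, hkc⟩ => ?_⟩
  · obtain ⟨e, he, hke⟩ := exists_edge_of_cover hψf hne hinj c hxy (by exact_mod_cast hk) h
    rw [hends] at he
    have hadj : G.Adj x y := by
      rw [← SimpleGraph.mem_edgeSet, ← he]
      exact e.2
    refine ⟨hadj, ?_⟩
    have : (⟨s(x, y), hadj⟩ : G.edgeSet) = e := Subtype.ext he.symm
    rw [this]
    exact_mod_cast hke
  · exact cover_of_edge (e₀ := ⟨s(x, y), h⟩) (hends _) (by exact_mod_cast hkc)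

end Scores

end CreditNetwork

theorem mainTheorem7 {V : Type*} [Fintype V] [DecidableEq V]
    (G : SimpleGraph V) [DecidableRel G.Adj] (hG : G.Connected)
    (c : G.edgeSet → ℝ≥0) (hc : CreditNetwork.Gam G c ≠ 0)
    (s : G.Dart → ℤˣ) (hs : CreditNetwork.IsOrientation s)
    (D : G.edgeSet → EuclideanSpace ℝ (Fin (Fintype.card V - 1)))
    (hD : CreditNetwork.IsSpanningRep s D)
    (x y : V) (hxy : x ≠ y) (k : ℝ) (hk : 0 < k) :
    1 - k * CreditNetwork.GamIdent G c x y / CreditNetwork.Gam G c ≤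
        CreditNetwork.successProb s D c x y k ∧
      (CreditNetwork.successProb s D c x y k =
          1 - k * CreditNetwork.GamIdent G c x y / CreditNetwork.Gam G c ↔
        ∃ h : G.Adj x y, k ≤ (c ⟨s(x, y), h⟩ : ℝ)) := by
  -- The vertex `x` makes the truncated subtraction exact; `none` is the vertex placed at the
  -- origin.
  have hcard : Fintype.card V = Fintype.card (Option (Fin (Fintype.card V - 1))) := by
    have : 0 < Fintype.card V := Fintype.card_pos_iff.2 ⟨x⟩
    simp only [Fintype.card_option, Fintype.card_fin]
    omega
  exact CreditNetwork.successProb_bound (Fintype.equivOfCardEq hcard) hG c hc hs D hD x y hxy k hk
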